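/- Let $\Sigma$ be a finite alphabet and let $w\in\Sigma^{\mathbb N}$ be an infinite word. Its complexity function $p_w(n)$ is the number of distinct factors (contiguous subwords) of $w$ of length $n$. The word $w$ is called recurrent if for any two finite factors $u_1,u_2$ of $w$ there is a finite word $v$ such that $u_1vu_2$ is a factor of $w$. The discrete derivative of $f\colon\mathbb N\to\mathbb N$ is $f'(n)=f(n)-f(n-1)$ for $n\ge 1$, with $f'(0)=0$. **Theorem.** Let $g\colon\mathbb N\to\mathbb N$ be any superlinear function, i.e. $\frac{g(n)}{n}\to\infty$ as $n\to\infty$. Then there exists a recurrent infinite word $w\in\Sigma^{\mathbb N}$ over a finite alphabet $\Sigma$ such that $p_w(n)\le g(n)$ for all sufficiently large $n$ and $$p_w'(n)\neq O\left(\frac{p_w(n)}{n}\right)\quad (n\to\infty).$$ In particular, Cassaigne's question has a negative answer: it is not true that every infinite word $w$ over a finite alphabet whose complexity is polynomially bounded (i.e. $p_w(n)=O(n^d)$ for some $d\in\mathbb N$) satisfies $p_w'(n)=O\left(\frac{p_w(n)}{n}\right)$. -/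

import Mathlib

namespace InfiniteWord

/-- The factor `w[i] w[i+1] ⋯ w[i+n-1]` of length `n` of the one-sided infinite word `w`
(letters are indexed from `0`). -/
def factor {A : Type*} (w : ℕ → A) (i n : ℕ) : List A :=
  (List.range n).map fun j => w (i + j)

/-- `L_w(n)`: the set of factors of `w` of length `n`. -/
def factorsOfLength {A : Type*} (w : ℕ → A) (n : ℕ) : Set (List A) :=
  {u | ∃ i, factor w i n = u}

/-- `L_w`: the set of all finite factors of `w`. -/
def language {A : Type*} (w : ℕ → A) : Set (List A) :=
  ⋃ n, factorsOfLength w n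

/-- Over a finite alphabet `L_w(n)` is finite, so that its `ncard` is its true cardinality. -/
theorem factorsOfLength_finite {A : Type*} [Finite A] (w : ℕ → A) (n : ℕ) :
    (factorsOfLength w n).Finite := by
  refine (List.finite_length_eq A n).subset ?_
  rintro u ⟨i, rfl⟩
  simp [factor]

/-- The complexity function `p_w(n) = #L_w(n)`. -/
noncomputable def complexity {A : Type*} (w : ℕ → A) (n : ℕ) : ℕ :=
  (factorsOfLength w n).ncard

/-- `w` is recurrent: for all factors `u₁, u₂` of `w` there is a word `v` such that
`u₁ v u₂` is a factor of `w`. -/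
def IsRecurrent {A : Type*} (w : ℕ → A) : Prop :=
  ∀ u₁ ∈ language w, ∀ u₂ ∈ language w, ∃ v : List A, u₁ ++ v ++ u₂ ∈ language w

/-- The discrete derivative `f'(n) = f(n) - f(n-1)`, with `f'(0) = 0`. -/
def discreteDeriv (f : ℕ → ℕ) : ℕ → ℤ
  | 0 => 0
  | n + 1 => (f (n + 1) : ℤ) - (f n : ℤ)

/-- `f'(n) = O(f(n) / n)` as `n → ∞`. -/
def DerivBounded (f : ℕ → ℕ) : Prop :=
  (fun n : ℕ => (discreteDeriv f n : ℝ)) =O[Filter.atTop] fun n : ℕ => (f n : ℝ) / (n : ℝ)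

/-- `f` is polynomially bounded. -/
def PolynomiallyBounded (f : ℕ → ℕ) : Prop :=
  ∃ d : ℕ, (fun n : ℕ => (f n : ℝ)) =O[Filter.atTop] fun n : ℕ => (n : ℝ) ^ d

/-- `g` is superlinear: `g(n) / n → ∞`. -/
def Superlinear (g : ℕ → ℕ) : Prop :=
  Filter.Tendsto (fun n : ℕ => (g n : ℝ) / (n : ℝ)) Filter.atTop Filter.atTop

end InfiniteWord

namespace InfiniteWord

/-! Each block consists of copies of the previous one, separated by runs of zeros that are long and
pairwise distinct in length; the word is the limit of these nested prefixes. Write `L k` and `G k`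
for the length and gap of level `k`. A window of length `n ≤ G k` sees at most one copy of block
`k`, so there are at most `n + L k` factors (`complexity_blockWord_le`), hence at most `2 * G k` at
`n = G k`. A window of length `2 * G k` can contain a whole run between two copies; the length of
the run and its offset both vary, giving about `k * G k` factors (`le_complexity_blockWord`). So
complexity grows by a factor of order `k` from `G k` to `2 * G k`, whereas a bounded derivative
ratio allows only a constant factor (`growth_of_deriv_le`). Since `L (k + 1)` is only `O(k) * G k`,
taking `G k` large keeps the complexity below `g`. -/

theorem factor_append {A : Type*} (w : ℕ → A) (i n m : ℕ) :
    factor w i n ++ factor w (i + n) m = factor w i (n + m) := by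
  simp [factor, List.range_add, Nat.add_assoc]

theorem factor_congr {A : Type*} {w w' : ℕ → A} {i i' n : ℕ}
    (h : ∀ j < n, w (i + j) = w' (i' + j)) : factor w i n = factor w' i' n := by
  simp only [factor]
  exact List.map_congr_left fun j hj => h j (List.mem_range.1 hj)

theorem apply_eq_of_factor_eq {A : Type*} {w w' : ℕ → A} {i i' n : ℕ}
    (h : factor w i n = factor w' i' n) {j : ℕ} (hj : j < n) : w (i + j) = w' (i' + j) := by
  simp only [factor] at h
  exact List.map_inj_left.1 h j (List.mem_range.2 hj)

/-- If `f' ≤ D f / n` on `(a, 2a]` then `f` grows at most by the factor `exp (2 D)` there. -/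
theorem growth_of_deriv_le {f : ℕ → ℕ} {D : ℝ} {a : ℕ} (hD : 0 < D) (ha : 2 * D ≤ a)
    (h : ∀ n, a ≤ n → (f (n + 1) : ℝ) - f n ≤ D * (f (n + 1) / ((n + 1 : ℕ) : ℝ))) :
    (f (2 * a) : ℝ) ≤ Real.exp (2 * D) * f a := by
  have ha0 : (0 : ℝ) < a := by linarith
  have step : ∀ n, a ≤ n → (f (n + 1) : ℝ) ≤ (1 + 2 * D / a) * f n := by
    intro n hn
    have hna : (a : ℝ) ≤ ((n + 1 : ℕ) : ℝ) := by exact_mod_cast hn.trans n.le_succ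
    have hf : (0 : ℝ) ≤ f (n + 1) := Nat.cast_nonneg _
    have h1 : (f (n + 1) : ℝ) - f n ≤ D / a * f (n + 1) := by
      refine (h n hn).trans ?_
      rw [div_mul_eq_mul_div, mul_div_assoc]
      gcongr
    have hx : 0 < D / a := by positivity
    have hx2 : D / a ≤ 1 / 2 := by
      rw [div_le_iff₀ ha0]; linarith
    rw [mul_div_assoc]
    generalize D / (a : ℝ) = x at *
    have h2 : (1 - x) * (f (n + 1) : ℝ) ≤ f n := by linarith
    have h3 := mul_le_mul_of_nonneg_left h2 (by linarith : (0 : ℝ) ≤ 1 + 2 * x)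
    -- `(1 + 2x)(1 - x) = 1 + x(1 - 2x)`, which is at least `1` as `x ≤ 1/2`.
    have h4 : 0 ≤ x * (1 - 2 * x) * (f (n + 1) : ℝ) :=
      mul_nonneg (mul_nonneg hx.le (by linarith)) hf
    nlinarith
  have iter : ∀ r : ℕ, (f (a + r) : ℝ) ≤ (1 + 2 * D / a) ^ r * f a := by
    intro r
    induction r with
    | zero => simp
    | succ r ih =>
      calc (f (a + (r + 1)) : ℝ) ≤ (1 + 2 * D / a) * f (a + r) := step (a + r) (by omega)
        _ ≤ (1 + 2 * D / a) * ((1 + 2 * D / a) ^ r * f a) := by gcongr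
        _ = _ := by ring
  rw [two_mul a]
  refine (iter a).trans ?_
  gcongr
  calc (1 + 2 * D / a) ^ a ≤ Real.exp (2 * D / a) ^ a := by
        gcongr
        rw [add_comm]
        exact Real.add_one_le_exp _
    _ = Real.exp (2 * D) := by
        rw [← Real.exp_nat_mul, mul_div_cancel₀ _ ha0.ne']

/-! ### Words built from sparse copies of blocks

`N` is a sequence of thresholds, below which the gaps of each level may not fall. -/

/-- The length of the `k`-th block. -/
def blockLength (N : ℕ → ℕ) : ℕ → ℕ
  | 0 => 1
  | k + 1 => (k + 1) * (blockLength N k + (blockLength N k + N k + 4 * (k + 1)) + (k + 1))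
      + blockLength N k

/-- The least distance between copies of the `k`-th block. -/
def blockGap (N : ℕ → ℕ) (k : ℕ) : ℕ := blockLength N k + N k + 4 * (k + 1)

/-- The position of the `s`-th copy of block `k` in block `k + 1`. -/
def blockShift (N : ℕ → ℕ) (k s : ℕ) : ℕ := s * (blockLength N k + blockGap N k + s)

/-- The positions of the ones in the `k`-th block. -/
def blockSupport (N : ℕ → ℕ) : ℕ → Set ℤ
  | 0 => {0}
  | k + 1 => {z | ∃ s ≤ k + 1, z - blockShift N k s ∈ blockSupport N k}

open Classical in
/-- The infinite word that has all blocks as prefixes. -/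
noncomputable def blockWord (N : ℕ → ℕ) (n : ℕ) : Bool :=
  decide (∃ k, (n : ℤ) ∈ blockSupport N k)

variable {N : ℕ → ℕ} {k : ℕ}

/-! ### Arithmetic of lengths, gaps and shifts -/

theorem blockLength_succ (N : ℕ → ℕ) (k : ℕ) :
    blockLength N (k + 1) = blockShift N k (k + 1) + blockLength N k := rfl

theorem blockShift_zero (N : ℕ → ℕ) (k : ℕ) : blockShift N k 0 = 0 := by
  simp [blockShift]

theorem blockShift_succ (N : ℕ → ℕ) (k s : ℕ) :
    blockShift N k (s + 1) = blockShift N k s + blockLength N k + blockGap N k + 2 * s + 1 := by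
  simp only [blockShift]; ring

theorem blockShift_mono (N : ℕ → ℕ) (k : ℕ) : Monotone (blockShift N k) :=
  monotone_nat_of_le_succ fun s => by rw [blockShift_succ]; omega

theorem blockShift_separated {s t : ℕ} (h : s < t) :
    blockShift N k s + blockLength N k + blockGap N k < blockShift N k t := by
  have h1 := blockShift_mono N k (Nat.succ_le_of_lt h)
  have h2 := blockShift_succ N k s
  simp only [Nat.succ_eq_add_one] at h1
  omega

theorem blockLength_pos (N : ℕ → ℕ) (k : ℕ) : 0 < blockLength N k := by
  induction k with
  | zero => exact Nat.one_pos
  | succ k ih => rw [blockLength_succ]; omega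

theorem blockGap_lt_blockLength_succ (N : ℕ → ℕ) (k : ℕ) :
    blockGap N k < blockLength N (k + 1) := by
  have h := blockShift_separated (N := N) (k := k) (Nat.succ_pos k)
  rw [blockLength_succ]
  simp only [Nat.succ_eq_add_one] at h
  omega

theorem blockLength_le_blockGap (N : ℕ → ℕ) (k : ℕ) : blockLength N k ≤ blockGap N k := by
  unfold blockGap; omega

theorem blockGap_strictMono (N : ℕ → ℕ) : StrictMono (blockGap N) :=
  strictMono_nat_of_lt_succ fun k =>
    (blockGap_lt_blockLength_succ N k).trans_le (blockLength_le_blockGap N _)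

theorem blockLength_strictMono (N : ℕ → ℕ) : StrictMono (blockLength N) :=
  strictMono_nat_of_lt_succ fun k =>
    (blockLength_le_blockGap N k).trans_lt (blockGap_lt_blockLength_succ N k)

theorem blockLength_succ_le (N : ℕ → ℕ) (k : ℕ) :
    blockLength N (k + 1) ≤ (3 * k + 4) * blockGap N k := by
  have h1 := blockLength_le_blockGap N k
  have h2 : k + 1 ≤ blockGap N k := by unfold blockGap; omega
  calc blockLength N (k + 1)
      = (k + 1) * (blockLength N k + blockGap N k + (k + 1)) + blockLength N k := rfl
    _ ≤ (k + 1) * (blockGap N k + blockGap N k + blockGap N k) + blockGap N k := by gcongr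
    _ = _ := by ring

/-! ### Structure of the blocks and recurrence of the word -/

theorem blockSupport_bounds {z : ℤ} (hz : z ∈ blockSupport N k) :
    0 ≤ z ∧ z < blockLength N k := by
  induction k generalizing z with
  | zero =>
    obtain rfl : z = 0 := hz
    simp [blockLength]
  | succ k ih =>
    obtain ⟨s, hs, hz⟩ := hz
    have h := ih hz
    have h1 := blockShift_mono N k hs
    rw [blockLength_succ]
    omega

/-- Every other copy is more than a gap away from copy `s`, so none reaches this range. -/
theorem add_blockShift_mem_iff {s : ℕ} (hs : s ≤ k + 1) {z : ℤ} (h1 : -(blockGap N k : ℤ) ≤ z)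
    (h2 : z ≤ blockLength N k + blockGap N k) :
    z + blockShift N k s ∈ blockSupport N (k + 1) ↔ z ∈ blockSupport N k := by
  constructor
  · rintro ⟨t, ht, hz⟩
    have hb := blockSupport_bounds hz
    rcases lt_trichotomy s t with hst | rfl | hst
    · have := blockShift_separated (N := N) (k := k) hst
      omega
    · simpa using hz
    · have := blockShift_separated (N := N) (k := k) hst
      omega
  · exact fun hz => ⟨s, hs, by simpa using hz⟩

theorem mem_blockSupport_succ_iff {z : ℤ} (h : z < blockLength N k) :
    z ∈ blockSupport N (k + 1) ↔ z ∈ blockSupport N k := by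
  rcases lt_or_ge z 0 with hz | hz
  · constructor <;> intro h' <;> have := blockSupport_bounds h' <;> omega
  · simpa [blockShift_zero] using
      add_blockShift_mem_iff (N := N) (k := k) (Nat.zero_le _) (z := z) (by omega) (by omega)

theorem mem_blockSupport_iff_of_le {l : ℕ} (hkl : k ≤ l) {z : ℤ} (h : z < blockLength N k) :
    z ∈ blockSupport N l ↔ z ∈ blockSupport N k := by
  induction l, hkl using Nat.le_induction with
  | base => rfl
  | succ l hkl ih =>
    have := (blockLength_strictMono N).monotone hkl
    rw [← ih]
    exact mem_blockSupport_succ_iff (by omega)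

theorem blockWord_eq_true_iff {n : ℕ} (h : n < blockLength N k) :
    blockWord N n = true ↔ (n : ℤ) ∈ blockSupport N k := by
  simp only [blockWord, decide_eq_true_eq]
  refine ⟨fun ⟨l, hl⟩ => ?_, fun h' => ⟨k, h'⟩⟩
  rcases le_total k l with hkl | hkl
  · exact (mem_blockSupport_iff_of_le hkl (by omega)).1 hl
  · exact (mem_blockSupport_iff_of_le hkl (blockSupport_bounds hl).2).2 hl

theorem first_mem_blockSupport (N : ℕ → ℕ) (k : ℕ) : 0 ∈ blockSupport N k := by
  induction k with
  | zero => rfl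
  | succ k ih => exact ⟨0, Nat.zero_le _, by simpa [blockShift_zero] using ih⟩

theorem last_mem_blockSupport (N : ℕ → ℕ) (k : ℕ) :
    (blockLength N k : ℤ) - 1 ∈ blockSupport N k := by
  induction k with
  | zero => simp [blockLength, blockSupport]
  | succ k ih =>
    refine ⟨k + 1, le_rfl, ?_⟩
    rw [blockLength_succ]
    convert ih using 1
    push_cast
    ring

theorem lt_blockLength (N : ℕ → ℕ) (k : ℕ) : k < blockLength N k := by
  induction k with
  | zero => exact blockLength_pos N 0
  | succ k ih =>
    exact (Nat.succ_le_of_lt ih).trans_lt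
      (blockLength_strictMono N k.lt_succ_self)

theorem blockWord_add_blockShift {s i : ℕ} (hs : s ≤ k + 1) (hi : i < blockLength N k) :
    blockWord N (i + blockShift N k s) = blockWord N i := by
  have h := blockShift_mono N k hs
  rw [Bool.eq_iff_iff, blockWord_eq_true_iff hi,
    blockWord_eq_true_iff (k := k + 1) (by rw [blockLength_succ]; omega)]
  push_cast
  exact add_blockShift_mem_iff hs (by omega) (by omega)

/-- Both factors occur in a common prefix block, and the second recurs in the next copy of that
block, beyond the first. -/
theorem blockWord_isRecurrent (N : ℕ → ℕ) : IsRecurrent (blockWord N) := by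
  simp only [IsRecurrent, language, factorsOfLength, Set.mem_iUnion, Set.mem_ofPred_eq]
  rintro _ ⟨n, i, rfl⟩ _ ⟨m, j, rfl⟩
  obtain ⟨k, hk⟩ : ∃ k, i + n + (j + m) < blockLength N k := ⟨_, lt_blockLength N _⟩
  have hsep := blockShift_separated (N := N) (k := k) Nat.one_pos
  have hcopy : factor (blockWord N) j m = factor (blockWord N) (j + blockShift N k 1) m :=
    factor_congr fun r hr => by
      rw [add_right_comm]
      exact (blockWord_add_blockShift (by omega) (by omega)).symm
  have hpos : j + blockShift N k 1 = i + (n + (j + blockShift N k 1 - (i + n))) := by omega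
  refine ⟨factor (blockWord N) (i + n) (j + blockShift N k 1 - (i + n)),
    n + (j + blockShift N k 1 - (i + n)) + m, i, ?_⟩
  rw [factor_append, hcopy, ← factor_append, ← hpos]

/-! ### Upper bound for the complexity -/

/-- A window of length at most the `k`-th gap sees at most one copy of block `k`. -/
theorem exists_window_of_succ {n : ℕ} (hn : n ≤ blockGap N k) (i : ℤ) :
    ∃ i' : ℤ, ∀ j : ℕ, j < n →
      (i + j ∈ blockSupport N (k + 1) ↔ i' + j ∈ blockSupport N k) := by
  by_cases h : ∃ s ≤ k + 1, ∃ j < n, i + j - blockShift N k s ∈ blockSupport N k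
  · obtain ⟨s, hs, j₀, hj₀, hmem⟩ := h
    have hb := blockSupport_bounds hmem
    refine ⟨i - blockShift N k s, fun j hj => ?_⟩
    rw [← add_blockShift_mem_iff hs (by omega) (by omega)]
    ring_nf
  -- The window meets no one, so it matches a window starting past the end of the block.
  · refine ⟨blockLength N k, fun j hj => ?_⟩
    constructor
    · rintro ⟨s, hs, hz⟩
      exact absurd ⟨s, hs, j, hj, hz⟩ h
    · intro hz
      have := (blockSupport_bounds hz).2
      omega

theorem exists_window {l n : ℕ} (hkl : k ≤ l) (hn : n ≤ blockGap N k) (i : ℤ) :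
    ∃ i' : ℤ, ∀ j : ℕ, j < n → (i + j ∈ blockSupport N l ↔ i' + j ∈ blockSupport N k) := by
  induction l, hkl using Nat.le_induction generalizing i with
  | base => exact ⟨i, fun _ _ => Iff.rfl⟩
  | succ l hkl ih =>
    obtain ⟨i₁, h₁⟩ := exists_window_of_succ (N := N) (k := l)
      (hn.trans ((blockGap_strictMono N).monotone hkl)) i
    obtain ⟨i₂, h₂⟩ := ih i₁
    exact ⟨i₂, fun j hj => (h₁ j hj).trans (h₂ j hj)⟩

theorem complexity_blockWord_le {n : ℕ} (hn : n ≤ blockGap N k) :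
    complexity (blockWord N) n ≤ n + blockLength N k := by
  classical
  have hpos := blockLength_pos N k
  let u : ℤ → List Bool := fun i =>
    (List.range n).map fun j : ℕ => decide (i + (j : ℤ) ∈ blockSupport N k)
  have hsub : factorsOfLength (blockWord N) n ⊆
      ((Finset.Ico (-(n : ℤ)) (blockLength N k)).image u : Finset (List Bool)) := by
    rintro _ ⟨i, rfl⟩
    have hi : i + n < blockLength N (max k (i + n)) :=
      (le_max_right _ _).trans_lt (lt_blockLength N _)
    obtain ⟨i', h'⟩ := exists_window (N := N) (le_max_left k (i + n)) hn i
    have hfac : factor (blockWord N) i n = u i' := by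
      refine List.map_congr_left fun j hj => ?_
      have hj := List.mem_range.1 hj
      rw [Bool.eq_iff_iff, blockWord_eq_true_iff (k := max k (i + n)) (by omega),
        decide_eq_true_eq, ← h' j hj]
      push_cast
      rfl
    rw [hfac, Finset.coe_image, Set.mem_image]
    by_cases hmem : i' ∈ Finset.Ico (-(n : ℤ)) (blockLength N k)
    · exact ⟨i', hmem, rfl⟩
    -- Windows that miss the block are all zero, like the one ending just before it.
    · refine ⟨-n, by simp; omega, List.map_congr_left fun j hj => ?_⟩
      have hj := List.mem_range.1 hj
      rw [Finset.mem_Ico] at hmem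
      rw [decide_eq_decide]
      constructor <;> intro hz <;> have := blockSupport_bounds hz <;> omega
  calc complexity (blockWord N) n
      ≤ (((Finset.Ico (-(n : ℤ)) (blockLength N k)).image u : Finset (List Bool)) :
          Set (List Bool)).ncard := Set.ncard_le_ncard hsub (Finset.finite_toSet _)
    _ ≤ (Finset.Ico (-(n : ℤ)) (blockLength N k)).card := by
        rw [Set.ncard_coe_finset]
        exact Finset.card_image_le
    _ = n + blockLength N k := by
        rw [Int.card_Ico]; omega

/-! ### Lower bound for the complexity -/

theorem blockWord_last {s : ℕ} (hs : s ≤ k + 1) :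
    blockWord N (blockShift N k s + blockLength N k - 1) = true := by
  have hpos := blockLength_pos N k
  rw [show blockShift N k s + blockLength N k - 1 = blockLength N k - 1 + blockShift N k s by omega,
    blockWord_add_blockShift hs (by omega), blockWord_eq_true_iff (k := k) (by omega)]
  convert last_mem_blockSupport N k using 1
  omega

theorem blockWord_first {s : ℕ} (hs : s ≤ k + 1) : blockWord N (blockShift N k s) = true := by
  have hpos := blockLength_pos N k
  rw [show blockShift N k s = 0 + blockShift N k s by omega,
    blockWord_add_blockShift hs hpos, blockWord_eq_true_iff hpos]
  exact first_mem_blockSupport N k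

theorem blockWord_between {s i : ℕ} (hs : s ≤ k) (h1 : blockShift N k s + blockLength N k ≤ i)
    (h2 : i < blockShift N k (s + 1)) : blockWord N i = false := by
  have hmono := blockShift_mono N k (Nat.succ_le_succ hs)
  simp only [Nat.succ_eq_add_one] at hmono
  rw [← Bool.not_eq_true, blockWord_eq_true_iff (k := k + 1) (by rw [blockLength_succ]; omega)]
  rintro ⟨t, ht, hz⟩
  have hb := blockSupport_bounds hz
  rcases Nat.lt_or_ge s t with hst | hst
  · have := blockShift_mono N k (Nat.succ_le_of_lt hst)
    simp only [Nat.succ_eq_add_one] at this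
    omega
  · have := blockShift_mono N k hst
    omega

theorem le_complexity_blockWord (N : ℕ → ℕ) (k : ℕ) :
    k * (blockGap N k - 2 * (k + 1)) ≤ complexity (blockWord N) (2 * blockGap N k) := by
  classical
  set a := blockGap N k with ha
  -- For `q = (s, j)`, the last one of copy `s + 1` stands at offset `j`. Skipping copy `0` keeps
  -- the subtraction from truncating.
  let start : ℕ × ℕ → ℕ := fun q => blockShift N k (q.1 + 1) + blockLength N k - 1 - q.2
  let u : ℕ × ℕ → List Bool := fun q => factor (blockWord N) (start q) (2 * a)
  have hpos := blockLength_pos N k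
  have key : ∀ q ∈ Finset.range k ×ˢ Finset.range (a - 2 * (k + 1)),
      q.1 < k ∧ q.2 + 2 * (k + 1) < a ∧ blockWord N (start q + q.2) = true ∧
      blockWord N (start q + (q.2 + a + 2 * q.1 + 4)) = true ∧
      ∀ j, q.2 < j → j < q.2 + a + 2 * q.1 + 4 → blockWord N (start q + j) = false := by
    rintro ⟨s, j⟩ hq
    obtain ⟨hs, hj⟩ : s < k ∧ j < a - 2 * (k + 1) := by simpa using hq
    have h0 := blockShift_separated (N := N) (k := k) (Nat.succ_pos s)
    have h1 := blockShift_succ N k (s + 1)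
    simp only [Nat.succ_eq_add_one] at h0
    refine ⟨hs, by simp only; omega, ?_, ?_, ?_⟩
    · rw [show start (s, j) + j = blockShift N k (s + 1) + blockLength N k - 1 by
        simp only [start]; omega]
      exact blockWord_last (by omega)
    · rw [show start (s, j) + (j + a + 2 * s + 4) = blockShift N k (s + 1 + 1) by
        simp only [start]; omega]
      exact blockWord_first (by omega)
    · intro i hi1 hi2
      simp only at hi1 hi2
      exact blockWord_between (k := k) (s := s + 1) (by omega) (by simp only [start]; omega)
        (by simp only [start]; omega)
  have hinj : Set.InjOn u (Finset.range k ×ˢ Finset.range (a - 2 * (k + 1)) : Finset (ℕ × ℕ)) := by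
    -- The run of zeros is bounded by ones at both ends, so the window determines its offset and
    -- then its length.
    have hle : ∀ q ∈ Finset.range k ×ˢ Finset.range (a - 2 * (k + 1)),
        ∀ q' ∈ Finset.range k ×ˢ Finset.range (a - 2 * (k + 1)), u q = u q' →
        q'.2 ≤ q.2 ∧ (q'.2 = q.2 → q'.1 ≤ q.1) := by
      intro q hq q' hq' heq
      obtain ⟨hs, hj, hone, hone', hzero⟩ := key q hq
      obtain ⟨hs', hj', hone₂, hone₂', hzero₂⟩ := key q' hq'
      constructor
      · by_contra hlt
        have h := apply_eq_of_factor_eq heq (j := q'.2) (by omega)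
        rw [hone₂, hzero _ (by omega) (by omega)] at h
        exact Bool.false_ne_true h
      · intro hjj
        by_contra hlt
        have h := apply_eq_of_factor_eq heq (j := q.2 + a + 2 * q.1 + 4) (by omega)
        rw [hone', hzero₂ _ (by omega) (by omega)] at h
        exact Bool.false_ne_true h.symm
    intro q hq q' hq' heq
    obtain ⟨h1, h2⟩ := hle q hq q' hq' heq
    obtain ⟨h3, h4⟩ := hle q' hq' q hq heq.symm
    have h5 := le_antisymm h1 h3
    exact Prod.ext (le_antisymm (h4 h5.symm) (h2 h5)) h5.symm
  calc k * (a - 2 * (k + 1))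
      = (Finset.range k ×ˢ Finset.range (a - 2 * (k + 1))).card := by simp
    _ = ((Finset.range k ×ˢ Finset.range (a - 2 * (k + 1))).image u).card :=
        (Finset.card_image_of_injOn hinj).symm
    _ = (((Finset.range k ×ˢ Finset.range (a - 2 * (k + 1))).image u : Finset (List Bool)) :
          Set (List Bool)).ncard := (Set.ncard_coe_finset _).symm
    _ ≤ complexity (blockWord N) (2 * a) := by
        refine Set.ncard_le_ncard ?_ (factorsOfLength_finite _ _)
        intro x hx
        obtain ⟨q, -, rfl⟩ := Finset.mem_image.1 (Finset.mem_coe.1 hx)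
        exact ⟨start q, rfl⟩

/-! ### Conclusion -/

theorem not_derivBounded_complexity_blockWord (N : ℕ → ℕ) :
    ¬ DerivBounded (complexity (blockWord N)) := by
  intro h
  obtain ⟨C, hC⟩ := h.bound
  obtain ⟨n₀, hn₀⟩ := Filter.eventually_atTop.1 hC
  set D : ℝ := max C 1
  have hD : 0 < D := lt_max_of_lt_right one_pos
  obtain ⟨k, hk⟩ := exists_nat_gt (max (n₀ : ℝ) (max (2 * D) (4 * Real.exp (2 * D))))
  simp only [max_lt_iff] at hk
  obtain ⟨hk₀, hk₁, hk₂⟩ := hk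
  -- Hence at least half of the offsets below the gap remain in the lower bound.
  have hgap : 4 * (k + 1) ≤ blockGap N k := by unfold blockGap; omega
  have hka : (k : ℝ) ≤ blockGap N k := by exact_mod_cast (by omega : k ≤ blockGap N k)
  have hgrow := growth_of_deriv_le (f := complexity (blockWord N)) hD (hk₁.le.trans hka)
    fun n hn => by
      have hn' : n₀ ≤ n + 1 := by
        have : n₀ < k := by exact_mod_cast hk₀
        omega
      have hb := hn₀ (n + 1) hn'
      simp only [discreteDeriv] at hb
      push_cast at hb
      rw [Real.norm_eq_abs, Real.norm_of_nonneg (by positivity)] at hb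
      refine (le_abs_self _).trans (hb.trans ?_)
      push_cast
      gcongr
      exact le_max_left _ _
  have hup : (complexity (blockWord N) (blockGap N k) : ℝ) ≤ 2 * blockGap N k := by
    have h1 := complexity_blockWord_le (N := N) (k := k) le_rfl
    have h2 := blockLength_le_blockGap N k
    exact_mod_cast (by omega :
      complexity (blockWord N) (blockGap N k) ≤ 2 * blockGap N k)
  have hlow : (k : ℝ) * blockGap N k ≤ 2 * complexity (blockWord N) (2 * blockGap N k) := by
    have h1 := le_complexity_blockWord N k
    have h2 : k * blockGap N k ≤ k * (2 * (blockGap N k - 2 * (k + 1))) :=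
      Nat.mul_le_mul_left _ (by omega)
    have h3 : k * blockGap N k ≤ 2 * complexity (blockWord N) (2 * blockGap N k) := by
      linarith [mul_left_comm k 2 (blockGap N k - 2 * (k + 1))]
    exact_mod_cast h3
  have hapos : (0 : ℝ) < blockGap N k := by exact_mod_cast (by omega : 0 < blockGap N k)
  have h1 := mul_le_mul_of_nonneg_left hup (Real.exp_pos (2 * D)).le
  have h2 := mul_lt_mul_of_pos_right hk₂ hapos
  linarith

/-- For `G k < n ≤ G (k + 1)` the upper bound at level `k + 1` is at most `(3k + 5) n`, and `n`
exceeds `N k` because `G k ≥ N k`. -/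
theorem complexity_blockWord_le_of_threshold {g : ℕ → ℕ}
    (hN : ∀ k n, N k ≤ n → 5 * (k + 1) * n ≤ g n) {n : ℕ} (hn : blockGap N 0 < n) :
    complexity (blockWord N) n ≤ g n := by
  obtain ⟨k, hk₁, hk₂⟩ : ∃ k, blockGap N k < n ∧ n ≤ blockGap N (k + 1) := by
    by_contra! hcon
    have hall : ∀ k, blockGap N k < n := fun k => by
      induction k with
      | zero => exact hn
      | succ k ih => exact hcon k ih
    exact absurd (hall n) (not_lt.2 (blockGap_strictMono N).le_apply)
  have hNk : N k ≤ n := by unfold blockGap at hk₁; omega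
  calc complexity (blockWord N) n ≤ n + blockLength N (k + 1) := complexity_blockWord_le hk₂
    _ ≤ n + (3 * k + 4) * n := by
        gcongr
        exact (blockLength_succ_le N k).trans (Nat.mul_le_mul_left _ hk₁.le)
    _ ≤ 5 * (k + 1) * n := by nlinarith
    _ ≤ g n := hN k n hNk

theorem Superlinear.exists_threshold {g : ℕ → ℕ} (hg : Superlinear g) :
    ∃ N : ℕ → ℕ, ∀ k n, N k ≤ n → 5 * (k + 1) * n ≤ g n := by
  have h : ∀ k : ℕ, ∃ n₀, ∀ n, n₀ ≤ n → 5 * (k + 1) * n ≤ g n := fun k => by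
    obtain ⟨n₀, hn₀⟩ := Filter.eventually_atTop.1
      (hg.eventually_ge_atTop ((5 * (k + 1) : ℕ) : ℝ))
    refine ⟨n₀, fun n hn => ?_⟩
    rcases n.eq_zero_or_pos with rfl | hpos
    · simp
    · have h := hn₀ n hn
      rw [le_div_iff₀ (by exact_mod_cast hpos)] at h
      exact_mod_cast h
  choose N hN using h
  exact ⟨N, hN⟩

theorem exists_isRecurrent_complexity_le {g : ℕ → ℕ} (hg : Superlinear g) :
    ∃ w : ℕ → Bool, IsRecurrent w ∧ (∀ᶠ n in Filter.atTop, complexity w n ≤ g n) ∧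
      ¬ DerivBounded (complexity w) := by
  obtain ⟨N, hN⟩ := hg.exists_threshold
  refine ⟨blockWord N, blockWord_isRecurrent N, ?_, not_derivBounded_complexity_blockWord N⟩
  filter_upwards [Filter.eventually_gt_atTop (blockGap N 0)] with n hn
  exact complexity_blockWord_le_of_threshold hN hn

theorem superlinear_sq : Superlinear fun n => n ^ 2 := by
  refine tendsto_natCast_atTop_atTop.congr fun n => ?_
  rcases eq_or_ne n 0 with rfl | hn
  · simp
  · have : (n : ℝ) ≠ 0 := Nat.cast_ne_zero.2 hn
    push_cast
    field_simp

end InfiniteWord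

theorem theorem1p1 :
    (∀ g : ℕ → ℕ, InfiniteWord.Superlinear g →
      ∃ (A : Type) (_ : Finite A) (w : ℕ → A),
        InfiniteWord.IsRecurrent w ∧
        (∀ᶠ n in Filter.atTop, InfiniteWord.complexity w n ≤ g n) ∧
        ¬ InfiniteWord.DerivBounded (InfiniteWord.complexity w)) ∧
    ¬ (∀ (A : Type) (_ : Finite A) (w : ℕ → A),
        InfiniteWord.PolynomiallyBounded (InfiniteWord.complexity w) →
        InfiniteWord.DerivBounded (InfiniteWord.complexity w)) := by
  refine ⟨fun g hg => ?_, fun h => ?_⟩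
  · obtain ⟨w, hw⟩ := InfiniteWord.exists_isRecurrent_complexity_le hg
    exact ⟨Bool, inferInstance, w, hw⟩
  · obtain ⟨w, -, hle, hnot⟩ :=
      InfiniteWord.exists_isRecurrent_complexity_le InfiniteWord.superlinear_sq
    refine hnot (h Bool inferInstance w ⟨2, Asymptotics.IsBigO.of_bound 1 ?_⟩)
    filter_upwards [hle] with n hn
    rw [one_mul, Real.norm_of_nonneg (by positivity), Real.norm_of_nonneg (by positivity)]
    exact_mod_cast hn
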